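/- Let $n\in\mathbb N$, $0\le\alpha<\pi/2$, and let $A,B\in M_n(\mathbb C)$ be sectorial with angle $\alpha$, i.e. the numerical ranges $W(A)=\{\langle Ax,x\rangle:\|x\|=1\}$ and $W(B)$ are contained in $S_\alpha=\{z\in\mathbb C:\operatorname{Re}z>0,\ |\operatorname{Im}z|\le\tan(\alpha)\operatorname{Re}z\}$. Let $q\in\mathbb C$ with $0<|q|\le 1$, and let $$w_q(T)=\sup\{|\langle Tx,y\rangle| : x,y\in\mathbb C^n,\ \|x\|=\|y\|=1,\ \langle x,y\rangle=q\}$$ be the $q$-numerical radius of $T\in M_n(\mathbb C)$ (with $\sup\emptyset=0$). For $0<t<1$ let $$A\#_tB=\frac{\sin(\pi t)}{\pi}\int_0^\infty s^{t-1}\,(A^{-1}+sB^{-1})^{-1}\,ds$$ be the weighted geometric mean, and put $$\mathcal L(A,B)=\int_0^1 A\#_tB\,dt,\qquad \mathcal H_t(A,B)=\tfrac12\bigl(A\#_tB+A\#_{1-t}B\bigr).$$ For real $a,b\ge 0$ put $a\#_tb=a^{1-t}b^t$, $\mathcal L(a,b)=\int_0^1 a^{1-t}b^t\,dt$ and $\mathcal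 H_t(a,b)=\tfrac12\bigl(a^{1-t}b^t+a^tb^{1-t}\bigr)$. Then (a) $|q|^2\,w_q(\mathcal L(A,B))\le\sec^3(\alpha)\,\mathcal L(w_q(A),w_q(B))$; (b) $|q|^2\,w_q(\mathcal H_t(A,B))\le\sec^3(\alpha)\,\mathcal H_t(w_q(A),w_q(B))$ for every $0<t<1$. -/

import Mathlib

namespace SectorialMeans

/-- The numerical range `W(A) = {⟨Ax, x⟩ : ‖x‖ = 1}`. The mathematical inner product `⟨u, v⟩`,
linear in its first argument, is `inner ℂ v u` in Mathlib. -/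
def numericalRange {n : ℕ} (A : Matrix (Fin n) (Fin n) ℂ) : Set ℂ :=
  {z | ∃ x : EuclideanSpace ℂ (Fin n), ‖x‖ = 1 ∧ z = inner ℂ x (Matrix.toEuclideanLin A x)}

/-- The sector `{z : Re z > 0, |Im z| ≤ tan α * Re z}`. -/
def sector (α : ℝ) : Set ℂ :=
  {z | 0 < z.re ∧ |z.im| ≤ Real.tan α * z.re}

/-- `A` is sectorial with angle `α`. -/
def IsSectorial {n : ℕ} (α : ℝ) (A : Matrix (Fin n) (Fin n) ℂ) : Prop :=
  numericalRange A ⊆ sector α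

/-- The `q`-numerical range `{⟨Ax, y⟩ : ‖x‖ = ‖y‖ = 1, ⟨x, y⟩ = q}`. -/
def qNumericalRange {n : ℕ} (q : ℂ) (A : Matrix (Fin n) (Fin n) ℂ) : Set ℂ :=
  {z | ∃ x y : EuclideanSpace ℂ (Fin n), ‖x‖ = 1 ∧ ‖y‖ = 1 ∧ inner ℂ y x = q ∧
    z = inner ℂ y (Matrix.toEuclideanLin A x)}

/-- The `q`-numerical radius `sup {|z| : z ∈ W_q(A)}`. -/
noncomputable def qNumericalRadius {n : ℕ} (q : ℂ) (A : Matrix (Fin n) (Fin n) ℂ) : ℝ :=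
  sSup ((fun z : ℂ => ‖z‖) '' qNumericalRange q A)

/-- The weighted geometric mean of accretive matrices,
`A #_t B = (sin (π t) / π) ∫_0^∞ s^(t-1) (A⁻¹ + s B⁻¹)⁻¹ ds` for `0 < t < 1`;
the matrix integral is taken entrywise. -/
noncomputable def geomMean {n : ℕ} (t : ℝ) (A B : Matrix (Fin n) (Fin n) ℂ) :
    Matrix (Fin n) (Fin n) ℂ :=
  Matrix.of fun i j =>
    ((Real.sin (Real.pi * t) / Real.pi : ℝ) : ℂ) *
      ∫ s in Set.Ioi (0 : ℝ), ((s ^ (t - 1) : ℝ) : ℂ) * (A⁻¹ + (s : ℂ) • B⁻¹)⁻¹ i j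

/-- The logarithmic mean `∫_0^1 A #_t B dt` of accretive matrices (entrywise integral). -/
noncomputable def logMean {n : ℕ} (A B : Matrix (Fin n) (Fin n) ℂ) :
    Matrix (Fin n) (Fin n) ℂ :=
  Matrix.of fun i j => ∫ t in Set.Ioo (0 : ℝ) 1, geomMean t A B i j

/-- The Heinz mean `(A #_t B + A #_{1-t} B) / 2` of accretive matrices. -/
noncomputable def heinzMean {n : ℕ} (t : ℝ) (A B : Matrix (Fin n) (Fin n) ℂ) :
    Matrix (Fin n) (Fin n) ℂ :=
  (1 / 2 : ℂ) • (geomMean t A B + geomMean (1 - t) A B)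

/-- The weighted geometric mean `a #_t b = a^(1-t) b^t` of nonnegative reals. -/
noncomputable def scalarGeomMean (t a b : ℝ) : ℝ := a ^ (1 - t) * b ^ t

/-- The logarithmic mean `∫_0^1 a #_t b dt` of nonnegative reals. -/
noncomputable def scalarLogMean (a b : ℝ) : ℝ :=
  ∫ t in Set.Ioo (0 : ℝ) 1, scalarGeomMean t a b

/-- The Heinz mean `(a #_t b + a #_{1-t} b) / 2` of nonnegative reals. -/
noncomputable def scalarHeinzMean (t a b : ℝ) : ℝ :=
  (scalarGeomMean t a b + scalarGeomMean (1 - t) a b) / 2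

end SectorialMeans

/-! The argument compares sesquilinear forms with scalars. If a matrix is sectorial and Re⟨Ax,x⟩ ≤
a‖x‖², a sharp Cauchy–Schwarz inequality on the sector gives Re⟨A⁻¹u,u⟩ ≥ cos²(α) a⁻¹‖u‖². Hence A⁻¹
+ sB⁻¹ has real part at least cos²(α)(a⁻¹ + s b⁻¹), and its inverse has norm at most sec²(α)(a⁻¹ + s
b⁻¹)⁻¹ (`norm_inner_resolvent_le`). The factor sec²(α) does not depend on s, and the remaining
scalar integral is exactly the one representing a^(1-t) b^t, so every mean of A and B is bounded in
norm by sec²(α) times the scalar mean of a and b.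

The link with the q-numerical radius is |q| |⟨Ax,x⟩| ≤ w_q(A) for unit x
(`norm_mul_norm_inner_self_le`), which allows a = w_q(A)/|q| and b = w_q(B)/|q|. Homogeneity of the
means then gives |q| w_q(M) ≤ sec²(α) m(w_q(A), w_q(B)), which is stronger than the claim because
|q| ≤ 1 ≤ sec α. -/

open MeasureTheory Set
open scoped ComplexConjugate InnerProductSpace

namespace SectorialMeans

/-! ### Scalar integral representation of the weighted geometric mean. -/

theorem integrableOn_and_integral_beta {t : ℝ} (ht0 : 0 < t) (ht1 : t < 1) :
    IntegrableOn (fun x : ℝ => x ^ (t - 1) * (1 - x) ^ (-t)) (Ioo 0 1) ∧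
      ∫ x in Ioo (0 : ℝ) 1, x ^ (t - 1) * (1 - x) ^ (-t) = Real.pi / Real.sin (Real.pi * t) := by
  have hcongr : EqOn (fun x : ℝ => (x : ℂ) ^ ((t : ℂ) - 1) * (1 - (x : ℂ)) ^ ((1 - t : ℂ) - 1))
      (fun x : ℝ => ((x ^ (t - 1) * (1 - x) ^ (-t) : ℝ) : ℂ)) (Ioo 0 1) := by
    intro x hx
    have h1 : (0 : ℝ) ≤ 1 - x := by linarith [hx.2]
    simp only []
    push_cast [Complex.ofReal_cpow hx.1.le, Complex.ofReal_cpow h1]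
    congr 2
    ring
  have hint := Complex.betaIntegral_convergent (u := t) (v := 1 - t) (by simpa) (by simpa)
  rw [intervalIntegrable_iff_integrableOn_Ioo_of_le zero_le_one,
    integrableOn_congr_fun hcongr measurableSet_Ioo] at hint
  refine ⟨by simpa using! hint.re, ?_⟩
  have hG := Complex.Gamma_mul_Gamma_eq_betaIntegral (s := t) (t := 1 - t) (by simpa) (by simpa)
  rw [Complex.Gamma_mul_Gamma_one_sub, add_sub_cancel, Complex.Gamma_one, one_mul,
    Complex.betaIntegral, intervalIntegral.integral_of_le zero_le_one, integral_Ioc_eq_integral_Ioo,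
    setIntegral_congr_fun measurableSet_Ioo hcongr, integral_complex_ofReal] at hG
  exact_mod_cast hG.symm

theorem integrableOn_and_integral_rpow_mul_inv {t c d : ℝ} (ht0 : 0 < t) (ht1 : t < 1)
    (hc : 0 < c) (hd : 0 < d) :
    IntegrableOn (fun s : ℝ => s ^ (t - 1) * (c + s * d)⁻¹) (Ioi 0) ∧
      ∫ s in Ioi (0 : ℝ), s ^ (t - 1) * (c + s * d)⁻¹ =
        Real.pi / Real.sin (Real.pi * t) * (c⁻¹ ^ (1 - t) * d⁻¹ ^ t) := by
  -- The substitution x = sd/(c + sd) maps (0, ∞) onto (0, 1) and turns the beta integral B(t, 1 -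
  -- t) into the required one.
  set f : ℝ → ℝ := fun s => s * d / (c + s * d)
  set f' : ℝ → ℝ := fun s => c * d / (c + s * d) ^ 2
  have hpos : ∀ s ∈ Ioi (0 : ℝ), 0 < c + s * d := fun s hs => by
    have : 0 < s := hs
    positivity
  have hf : ∀ s ∈ Ioi (0 : ℝ), HasDerivWithinAt f (f' s) (Ioi 0) s := by
    intro s hs
    have h1 : HasDerivAt (fun s : ℝ => s * d) d s := by simpa using! (hasDerivAt_id s).mul_const d
    have h2 := h1.div (h1.const_add c) (hpos s hs).ne'
    refine (h2.congr_deriv ?_).hasDerivWithinAt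
    simp only [f']
    ring
  have hinj : InjOn f (Ioi 0) := by
    intro x hx y hy hxy
    have := hpos x hx
    have := hpos y hy
    simp only [f] at hxy
    rw [div_eq_div_iff (by positivity) (by positivity)] at hxy
    have h : (c * d) * (x - y) = 0 := by linear_combination hxy
    rcases mul_eq_zero.1 h with h | h
    · exact absurd h (by positivity)
    · linarith
  have himg : f '' Ioi 0 = Ioo 0 1 := by
    ext y
    constructor
    · rintro ⟨s, hs, rfl⟩
      have h := hpos s hs
      have : 0 < s := hs
      exact ⟨by positivity, (div_lt_one h).2 (by linarith)⟩
    · rintro ⟨h0, h1⟩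
      have h2 : 0 < 1 - y := by linarith
      refine ⟨c * y / (d * (1 - y)), by simp only [mem_Ioi]; positivity, ?_⟩
      simp only [f]
      field_simp
      ring
  have hcongr : EqOn (fun s => |f' s| • (f s ^ (t - 1) * (1 - f s) ^ (-t)))
      (fun s => (c ^ (1 - t) * d ^ t) * (s ^ (t - 1) * (c + s * d)⁻¹)) (Ioi 0) := by
    intro s hs
    have h := hpos s hs
    have hs' : 0 < s := hs
    have h1 : 1 - f s = c / (c + s * d) := by simp only [f]; field_simp; ring
    have h2 : |f' s| = f' s := abs_of_pos (by simp only [f']; positivity)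
    simp only [h1, h2]
    simp only [f, f', smul_eq_mul]
    rw [Real.div_rpow (by positivity) h.le, Real.div_rpow hc.le h.le,
      Real.mul_rpow hs'.le hd.le, Real.rpow_neg h.le, Real.rpow_neg hc.le,
      Real.rpow_sub_one hd.ne', Real.rpow_sub_one h.ne', Real.rpow_sub hc, Real.rpow_one]
    have := Real.rpow_pos_of_pos h t
    have := Real.rpow_pos_of_pos hc t
    field_simp
  obtain ⟨hi, hv⟩ := integrableOn_and_integral_beta ht0 ht1
  rw [← himg] at hi hv
  rw [integrableOn_image_iff_integrableOn_abs_deriv_smul measurableSet_Ioi hf hinj,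
    integrableOn_congr_fun hcongr measurableSet_Ioi] at hi
  rw [integral_image_eq_integral_abs_deriv_smul measurableSet_Ioi hf hinj,
    setIntegral_congr_fun measurableSet_Ioi hcongr, integral_const_mul] at hv
  have h1 := Real.rpow_pos_of_pos hc (1 - t)
  have h2 := Real.rpow_pos_of_pos hd t
  refine ⟨?_, ?_⟩
  · exact (integrable_const_mul_iff (isUnit_iff_ne_zero.2 (mul_pos h1 h2).ne') _).1 hi
  · rw [← hv, Real.inv_rpow hc.le, Real.inv_rpow hd.le]
    generalize ∫ s in Ioi (0 : ℝ), s ^ (t - 1) * (c + s * d)⁻¹ = I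
    field_simp

/-! ### Cauchy–Schwarz inequalities for sectorial forms. -/

section Form

variable {F : Type*} [NormedAddCommGroup F] [InnerProductSpace ℂ F]

/-- Cauchy–Schwarz for the Hermitian form `c ⟪x, T y⟫ + conj c ⟪T x, y⟫`, when it is positive. -/
theorem norm_hermitianPart_sq_le (T : F →ₗ[ℂ] F) (c : ℂ)
    (h : ∀ x, 0 ≤ (c * inner ℂ x (T x)).re) (x y : F) :
    ‖c * inner ℂ x (T y) + conj c * inner ℂ (T x) y‖ ^ 2 ≤
      (2 * (c * inner ℂ x (T x)).re) * (2 * (c * inner ℂ y (T y)).re) := by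
  have hre : ∀ z, (c * inner ℂ z (T z) + conj c * inner ℂ (T z) z).re =
      2 * (c * inner ℂ z (T z)).re := fun z => by
    rw [← inner_conj_symm (T z) z, ← map_mul, Complex.add_re, Complex.conj_re, two_mul]
  have hsymm : ∀ x y, conj (c * inner ℂ y (T x) + conj c * inner ℂ (T y) x) =
      c * inner ℂ x (T y) + conj c * inner ℂ (T x) y := fun x y => by
    simp only [map_add, map_mul, inner_conj_symm, Complex.conj_conj]
    ring
  -- The form may be degenerate, so only a semi-inner product is available; Cauchy–Schwarz still
  -- holds for it.
  let core : PreInnerProductSpace.Core ℂ F :=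
    { inner := fun x y => c * inner ℂ x (T y) + conj c * inner ℂ (T x) y
      conj_inner_symm := hsymm
      re_inner_nonneg := fun x => by
        have := h x
        have h2 := hre x
        simp only [RCLike.re_to_complex, h2]
        linarith
      add_left := fun x y z => by
        simp only [inner_add_left, map_add]
        ring
      smul_left := fun x y r => by
        simp only [inner_smul_left, map_smul]
        ring }
  have key := @InnerProductSpace.Core.inner_mul_inner_self_le ℂ F _ _ _ core x y
  have e1 : ‖c * inner ℂ y (T x) + conj c * inner ℂ (T y) x‖ =
      ‖c * inner ℂ x (T y) + conj c * inner ℂ (T x) y‖ := by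
    rw [← hsymm x y, Complex.norm_conj]
  change ‖c * inner ℂ x (T y) + conj c * inner ℂ (T x) y‖ *
    ‖c * inner ℂ y (T x) + conj c * inner ℂ (T y) x‖ ≤
      (c * inner ℂ x (T x) + conj c * inner ℂ (T x) x).re *
      (c * inner ℂ y (T y) + conj c * inner ℂ (T y) y).re at key
  rw [e1, hre, hre, ← sq] at key
  exact key

/-- With c = τ + i, the sector condition says that cT and its counterpart with conj c both have
nonnegative real part. Cauchy–Schwarz applies to the two resulting Hermitian forms, and T is a
combination of them in which the adjoint terms cancel. -/
theorem norm_inner_map_sq_le_of_pos (T : F →ₗ[ℂ] F) {τ : ℝ} (hτ : 0 < τ)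
    (h : ∀ x, |(inner ℂ x (T x)).im| ≤ τ * (inner ℂ x (T x)).re) (x y : F) :
    ‖inner ℂ x (T y)‖ ^ 2 ≤ (1 + τ ^ 2) * ((inner ℂ x (T x)).re * (inner ℂ y (T y)).re) := by
  set c : ℂ := ⟨τ, 1⟩
  have hc : ∀ z : ℂ, (c * z).re = τ * z.re - z.im := fun z => by simp [c]
  have hc' : ∀ z : ℂ, (conj c * z).re = τ * z.re + z.im := fun z => by simp [c]
  have h1 : ∀ x, 0 ≤ (c * inner ℂ x (T x)).re := fun x => by
    rw [hc]; linarith [(abs_le.1 (h x)).2]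
  have h2 : ∀ x, 0 ≤ (conj c * inner ℂ x (T x)).re := fun x => by
    rw [hc']; linarith [(abs_le.1 (h x)).1]
  have k1 := norm_hermitianPart_sq_le T c h1 x y
  have k2 := norm_hermitianPart_sq_le T (conj c) h2 x y
  rw [Complex.conj_conj] at k2
  set p := c * inner ℂ x (T y) + conj c * inner ℂ (T x) y
  set r := conj c * inner ℂ x (T y) + c * inner ℂ (T x) y
  have hpr : (4 * τ * Complex.I : ℂ) * inner ℂ x (T y) = c * p - conj c * r := by
    have : (4 * τ * Complex.I : ℂ) = c ^ 2 - conj c ^ 2 := by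
      apply Complex.ext <;> simp [c, pow_two]; ring
    rw [this]
    simp only [p, r]
    ring
  have hcn : ‖c‖ ^ 2 = 1 + τ ^ 2 := by
    rw [← Complex.normSq_eq_norm_sq, Complex.normSq_apply]
    simp only [c]
    ring
  have hnorm : 4 * τ * ‖inner ℂ x (T y)‖ ≤ ‖c‖ * (‖p‖ + ‖r‖) := by
    calc 4 * τ * ‖inner ℂ x (T y)‖ = ‖(4 * τ * Complex.I : ℂ) * inner ℂ x (T y)‖ := by
          simp [abs_of_pos hτ]
      _ ≤ ‖c * p‖ + ‖conj c * r‖ := by rw [hpr]; exact norm_sub_le _ _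
      _ = ‖c‖ * (‖p‖ + ‖r‖) := by rw [norm_mul, norm_mul, Complex.norm_conj]; ring
  have hP := h1 x
  have hP' := h1 y
  have hQ := h2 x
  have hQ' := h2 y
  have eX : τ * (inner ℂ x (T x)).re * 2 =
      (c * inner ℂ x (T x)).re + (conj c * inner ℂ x (T x)).re := by rw [hc, hc']; ring
  have eY : τ * (inner ℂ y (T y)).re * 2 =
      (c * inner ℂ y (T y)).re + (conj c * inner ℂ y (T y)).re := by rw [hc, hc']; ring
  set P := (c * inner ℂ x (T x)).re
  set P' := (c * inner ℂ y (T y)).re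
  set Q := (conj c * inner ℂ x (T x)).re
  set Q' := (conj c * inner ℂ y (T y)).re
  -- From ‖p‖² ≤ 4PP' and ‖r‖² ≤ 4QQ', AM–GM on PQ' and QP' bounds the cross term so that the sum
  -- factors as (P + Q)(P' + Q').
  have hmul : ‖p‖ * ‖r‖ ≤ 2 * (P * Q' + Q * P') := by
    apply abs_le_of_sq_le_sq' _ (by positivity) |>.2
    calc (‖p‖ * ‖r‖) ^ 2 = ‖p‖ ^ 2 * ‖r‖ ^ 2 := by ring
      _ ≤ (2 * P * (2 * P')) * (2 * Q * (2 * Q')) := by gcongr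
      _ ≤ _ := by nlinarith [sq_nonneg (P * Q' - Q * P')]
  have hsum : (‖p‖ + ‖r‖) ^ 2 ≤ 4 * ((P + Q) * (P' + Q')) := by
    nlinarith
  have h16 : 16 * τ ^ 2 * ‖inner ℂ x (T y)‖ ^ 2 ≤
      16 * τ ^ 2 * ((1 + τ ^ 2) * ((inner ℂ x (T x)).re * (inner ℂ y (T y)).re)) := by
    calc 16 * τ ^ 2 * ‖inner ℂ x (T y)‖ ^ 2 = (4 * τ * ‖inner ℂ x (T y)‖) ^ 2 := by ring
      _ ≤ (‖c‖ * (‖p‖ + ‖r‖)) ^ 2 := by gcongr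
      _ = (1 + τ ^ 2) * (‖p‖ + ‖r‖) ^ 2 := by rw [mul_pow, hcn]
      _ ≤ (1 + τ ^ 2) * (4 * ((P + Q) * (P' + Q'))) := by gcongr
      _ = _ := by rw [← eX, ← eY]; ring
  exact le_of_mul_le_mul_left h16 (by positivity)

/-- The sharp Cauchy–Schwarz inequality for a form with values in the sector of slope `τ`. -/
theorem norm_inner_map_sq_le (T : F →ₗ[ℂ] F) {τ : ℝ} (hτ : 0 ≤ τ)
    (hre : ∀ x, 0 ≤ (inner ℂ x (T x)).re)
    (h : ∀ x, |(inner ℂ x (T x)).im| ≤ τ * (inner ℂ x (T x)).re) (x y : F) :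
    ‖inner ℂ x (T y)‖ ^ 2 ≤ (1 + τ ^ 2) * ((inner ℂ x (T x)).re * (inner ℂ y (T y)).re) := by
  -- The case τ = 0 is not covered by the previous argument, which divides by τ; slopes σ > τ are
  -- used and σ tends to τ.
  have hlim : Filter.Tendsto (fun σ : ℝ => (1 + σ ^ 2) *
      ((inner ℂ x (T x)).re * (inner ℂ y (T y)).re)) (nhdsWithin τ (Ioi τ))
      (nhds ((1 + τ ^ 2) * ((inner ℂ x (T x)).re * (inner ℂ y (T y)).re))) := by
    refine Filter.Tendsto.mono_left (Continuous.tendsto ?_ τ) nhdsWithin_le_nhds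
    fun_prop
  refine ge_of_tendsto hlim ?_
  filter_upwards [self_mem_nhdsWithin] with σ hσ
  refine norm_inner_map_sq_le_of_pos T (hτ.trans_lt hσ) (fun z => (h z).trans ?_) x y
  exact mul_le_mul_of_nonneg_right (le_of_lt hσ) (hre z)

/-- Apply the sharp Cauchy–Schwarz inequality to the pair (Tv, v) and cancel ‖Tv‖². -/
theorem norm_map_sq_le (T : F →ₗ[ℂ] F) {τ a : ℝ} (hτ : 0 ≤ τ)
    (hre : ∀ x, 0 ≤ (inner ℂ x (T x)).re)
    (h : ∀ x, |(inner ℂ x (T x)).im| ≤ τ * (inner ℂ x (T x)).re)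
    (ha : ∀ x, (inner ℂ x (T x)).re ≤ a * ‖x‖ ^ 2) (v : F) :
    ‖T v‖ ^ 2 ≤ (1 + τ ^ 2) * a * (inner ℂ v (T v)).re := by
  rcases eq_or_ne (T v) 0 with h0 | h0
  · simp [h0]
  · have h1 := norm_inner_map_sq_le T hτ hre h (T v) v
    have hn : ‖inner ℂ (T v) (T v)‖ = ‖T v‖ ^ 2 := by
      rw [inner_self_eq_norm_sq_to_K]; simp
    rw [hn] at h1
    have hpos : 0 < ‖T v‖ ^ 2 := by positivity
    have h2 : ‖T v‖ ^ 2 * ‖T v‖ ^ 2 ≤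
        ‖T v‖ ^ 2 * ((1 + τ ^ 2) * a * (inner ℂ v (T v)).re) := by
      calc _ = (‖T v‖ ^ 2) ^ 2 := by ring
        _ ≤ _ := h1
        _ ≤ (1 + τ ^ 2) * ((a * ‖T v‖ ^ 2) * (inner ℂ v (T v)).re) := by
          gcongr
          · exact hre v
          · exact ha _
        _ = _ := by ring
    exact le_of_mul_le_mul_left h2 hpos

end Form

/-! ### Sectorial matrices, their inverses and the resolvent bound. -/

section Resolvent

variable {n : ℕ} {A B : Matrix (Fin n) (Fin n) ℂ} {α : ℝ}

theorem toEuclideanLin_mul_apply (A B : Matrix (Fin n) (Fin n) ℂ)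
    (x : EuclideanSpace ℂ (Fin n)) :
    Matrix.toEuclideanLin (A * B) x = Matrix.toEuclideanLin A (Matrix.toEuclideanLin B x) := by
  rw [Matrix.toEuclideanLin, Matrix.toLpLin_mul_same]
  rfl

theorem isUnit_det_of_re_inner_pos
    (h : ∀ x : EuclideanSpace ℂ (Fin n), x ≠ 0 → 0 < (inner ℂ x (Matrix.toEuclideanLin A x)).re) :
    IsUnit A.det := by
  rw [isUnit_iff_ne_zero]
  intro hdet
  obtain ⟨v, hv, hAv⟩ := Matrix.exists_mulVec_eq_zero_iff.2 hdet
  have h1 := h (WithLp.toLp 2 v) (by simpa using hv)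
  rw [Matrix.toLpLin_toLp, Matrix.toLin'_apply, hAv] at h1
  simp at h1

theorem toEuclideanLin_mul_inv_apply (hA : IsUnit A.det) (x : EuclideanSpace ℂ (Fin n)) :
    Matrix.toEuclideanLin A (Matrix.toEuclideanLin A⁻¹ x) = x := by
  rw [← toEuclideanLin_mul_apply, Matrix.mul_nonsing_inv _ hA, Matrix.toEuclideanLin,
    Matrix.toLpLin_one]
  rfl

theorem inner_toEuclideanLin_self_eq (A : Matrix (Fin n) (Fin n) ℂ)
    {x : EuclideanSpace ℂ (Fin n)} (hx : x ≠ 0) :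
    ∃ u : EuclideanSpace ℂ (Fin n), ‖u‖ = 1 ∧ inner ℂ x (Matrix.toEuclideanLin A x) =
      ((‖x‖ ^ 2 : ℝ) : ℂ) * inner ℂ u (Matrix.toEuclideanLin A u) := by
  have hn : (‖x‖ : ℂ) ≠ 0 := by simpa using hx
  refine ⟨(‖x‖⁻¹ : ℂ) • x, by simp [norm_smul, hx], ?_⟩
  rw [map_smul, inner_smul_left, inner_smul_right]
  simp only [map_inv₀, Complex.conj_ofReal]
  push_cast
  field_simp

theorem IsSectorial.re_inner_pos (hA : IsSectorial α A) {x : EuclideanSpace ℂ (Fin n)}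
    (hx : x ≠ 0) : 0 < (inner ℂ x (Matrix.toEuclideanLin A x)).re := by
  obtain ⟨u, hu, h⟩ := inner_toEuclideanLin_self_eq A hx
  rw [h, Complex.re_ofReal_mul]
  have := (hA ⟨u, hu, rfl⟩).1
  positivity

theorem IsSectorial.re_inner_nonneg (hA : IsSectorial α A) (x : EuclideanSpace ℂ (Fin n)) :
    0 ≤ (inner ℂ x (Matrix.toEuclideanLin A x)).re := by
  rcases eq_or_ne x 0 with rfl | hx
  · simp
  · exact (hA.re_inner_pos hx).le

theorem IsSectorial.abs_im_inner_le (hA : IsSectorial α A) (x : EuclideanSpace ℂ (Fin n)) :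
    |(inner ℂ x (Matrix.toEuclideanLin A x)).im| ≤
      Real.tan α * (inner ℂ x (Matrix.toEuclideanLin A x)).re := by
  rcases eq_or_ne x 0 with rfl | hx
  · simp
  · obtain ⟨u, hu, h⟩ := inner_toEuclideanLin_self_eq A hx
    rw [h, Complex.re_ofReal_mul, Complex.im_ofReal_mul, abs_mul, abs_of_nonneg (by positivity)]
    have := (hA ⟨u, hu, rfl⟩).2
    calc _ ≤ ‖x‖ ^ 2 * _ := mul_le_mul_of_nonneg_left this (by positivity)
      _ = _ := by ring

theorem IsSectorial.isUnit_det (hA : IsSectorial α A) : IsUnit A.det :=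
  isUnit_det_of_re_inner_pos fun _ hx => hA.re_inner_pos hx

theorem one_add_tan_sq (hα0 : 0 ≤ α) (hα : α < Real.pi / 2) :
    1 + Real.tan α ^ 2 = (1 / Real.cos α) ^ 2 := by
  have hc : 0 < Real.cos α := Real.cos_pos_of_mem_Ioo ⟨by linarith [Real.pi_pos], hα⟩
  rw [one_div, inv_pow, ← Real.inv_one_add_tan_sq hc.ne', inv_inv]

/-- The inverse of a sectorial matrix is bounded below by `cos² α / a` when the numerical range
of the matrix has real parts at most `a`. -/
theorem IsSectorial.le_re_inner_inv (hA : IsSectorial α A) (hα0 : 0 ≤ α) (hα : α < Real.pi / 2)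
    {a : ℝ} (ha0 : 0 < a)
    (ha : ∀ x, (inner ℂ x (Matrix.toEuclideanLin A x)).re ≤ a * ‖x‖ ^ 2)
    (u : EuclideanSpace ℂ (Fin n)) :
    Real.cos α ^ 2 * a⁻¹ * ‖u‖ ^ 2 ≤ (inner ℂ u (Matrix.toEuclideanLin A⁻¹ u)).re := by
  have hc : 0 < Real.cos α := Real.cos_pos_of_mem_Ioo ⟨by linarith [Real.pi_pos], hα⟩
  -- With v = A⁻¹u this bounds ‖u‖² by sec²(α) a Re⟨u, A⁻¹u⟩, up to conjugation.
  have h := norm_map_sq_le (Matrix.toEuclideanLin A) (Real.tan_nonneg_of_nonneg_of_le_pi_div_two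
    hα0 hα.le) hA.re_inner_nonneg hA.abs_im_inner_le ha (Matrix.toEuclideanLin A⁻¹ u)
  rw [toEuclideanLin_mul_inv_apply hA.isUnit_det, one_add_tan_sq hα0 hα] at h
  rw [← inner_conj_symm, Complex.conj_re]
  calc Real.cos α ^ 2 * a⁻¹ * ‖u‖ ^ 2 ≤ Real.cos α ^ 2 * a⁻¹ * _ :=
        mul_le_mul_of_nonneg_left h (by positivity)
    _ = _ := by field_simp

/-- Lower bounds on real parts add, and a matrix whose real part is at least k > 0 has an inverse of
norm at most 1/k. -/
theorem norm_inner_resolvent_le (hα0 : 0 ≤ α) (hα : α < Real.pi / 2)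
    (hA : IsSectorial α A) (hB : IsSectorial α B) {a b : ℝ} (ha0 : 0 < a) (hb0 : 0 < b)
    (ha : ∀ x, (inner ℂ x (Matrix.toEuclideanLin A x)).re ≤ a * ‖x‖ ^ 2)
    (hb : ∀ x, (inner ℂ x (Matrix.toEuclideanLin B x)).re ≤ b * ‖x‖ ^ 2)
    {s : ℝ} (hs : 0 < s) (x y : EuclideanSpace ℂ (Fin n)) :
    ‖inner ℂ y (Matrix.toEuclideanLin (A⁻¹ + (s : ℂ) • B⁻¹)⁻¹ x)‖ ≤
      (1 / Real.cos α) ^ 2 * (a⁻¹ + s * b⁻¹)⁻¹ * (‖x‖ * ‖y‖) := by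
  have hc : 0 < Real.cos α := Real.cos_pos_of_mem_Ioo ⟨by linarith [Real.pi_pos], hα⟩
  set M := A⁻¹ + (s : ℂ) • B⁻¹
  have hM : ∀ u : EuclideanSpace ℂ (Fin n), Real.cos α ^ 2 * (a⁻¹ + s * b⁻¹) * ‖u‖ ^ 2 ≤
      (inner ℂ u (Matrix.toEuclideanLin M u)).re := by
    intro u
    have h1 := hA.le_re_inner_inv hα0 hα ha0 ha u
    have h2 := mul_le_mul_of_nonneg_left (hB.le_re_inner_inv hα0 hα hb0 hb u) hs.le
    rw [map_add, map_smul, LinearMap.add_apply, LinearMap.smul_apply, inner_add_right,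
      inner_smul_right, Complex.add_re, Complex.re_ofReal_mul]
    linarith
  have hdet : IsUnit M.det := isUnit_det_of_re_inner_pos fun x hx =>
    lt_of_lt_of_le (by positivity) (hM x)
  set u := Matrix.toEuclideanLin M⁻¹ x
  have hu : Real.cos α ^ 2 * (a⁻¹ + s * b⁻¹) * ‖u‖ ^ 2 ≤ ‖u‖ * ‖x‖ := by
    have h := hM u
    rw [toEuclideanLin_mul_inv_apply hdet] at h
    exact h.trans ((Complex.re_le_norm _).trans (norm_inner_le_norm u x))
  have hu' : ‖u‖ ≤ (1 / Real.cos α) ^ 2 * (a⁻¹ + s * b⁻¹)⁻¹ * ‖x‖ := by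
    rcases eq_or_ne u 0 with h0 | h0
    · rw [h0, norm_zero]
      positivity
    · have hun : 0 < ‖u‖ := norm_pos_iff.2 h0
      have h3 : Real.cos α ^ 2 * (a⁻¹ + s * b⁻¹) * ‖u‖ ≤ ‖x‖ := by
        refine le_of_mul_le_mul_left ?_ hun
        linarith
      calc ‖u‖ = (1 / Real.cos α) ^ 2 * (a⁻¹ + s * b⁻¹)⁻¹ *
            (Real.cos α ^ 2 * (a⁻¹ + s * b⁻¹) * ‖u‖) := by
            generalize hk : a⁻¹ + s * b⁻¹ = k
            have : 0 < k := by rw [← hk]; positivity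
            field_simp
        _ ≤ _ := by gcongr
  calc _ ≤ ‖y‖ * ‖u‖ := norm_inner_le_norm _ _
    _ ≤ ‖y‖ * ((1 / Real.cos α) ^ 2 * (a⁻¹ + s * b⁻¹)⁻¹ * ‖x‖) := by gcongr
    _ = _ := by ring

end Resolvent

/-! ### Passing form bounds through the integrals defining the means. -/

section Integral

variable {n : ℕ}

theorem inner_toEuclideanLin_eq_sum (M : Matrix (Fin n) (Fin n) ℂ)
    (x y : EuclideanSpace ℂ (Fin n)) :
    inner ℂ y (Matrix.toEuclideanLin M x) = ∑ i, ∑ j, conj (y i) * x j * M i j := by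
  simp only [PiLp.inner_apply, Matrix.toLpLin_apply, Matrix.mulVec, dotProduct, RCLike.inner_apply,
    Finset.sum_mul]
  refine Finset.sum_congr rfl fun i _ => Finset.sum_congr rfl fun j _ => ?_
  ring

/-- A bound on the sesquilinear form of a matrix-valued function passes to its entrywise
integral. -/
theorem norm_inner_integral_le {X : Type*} [MeasurableSpace X] {μ : Measure X}
    {M : X → Matrix (Fin n) (Fin n) ℂ} {g : X → ℝ}
    (hM : ∀ i j, AEStronglyMeasurable (fun s => M s i j) μ) (hg : Integrable g μ)
    (h : ∀ᵐ s ∂μ, ∀ x y : EuclideanSpace ℂ (Fin n),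
      ‖inner ℂ y (Matrix.toEuclideanLin (M s) x)‖ ≤ g s * (‖x‖ * ‖y‖))
    (x y : EuclideanSpace ℂ (Fin n)) :
    ‖inner ℂ y (Matrix.toEuclideanLin (Matrix.of fun i j => ∫ s, M s i j ∂μ) x)‖ ≤
      (∫ s, g s ∂μ) * (‖x‖ * ‖y‖) := by
  -- Testing the form bound on standard basis vectors dominates each entry by `g`.
  have hint : ∀ i j, Integrable (fun s => M s i j) μ := by
    intro i j
    refine hg.mono' (hM i j) ?_
    filter_upwards [h] with s hs
    have := hs (EuclideanSpace.single j 1) (EuclideanSpace.single i 1)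
    rw [inner_toEuclideanLin_eq_sum] at this
    simpa [Pi.single_apply, apply_ite] using this
  have heq : inner ℂ y (Matrix.toEuclideanLin (Matrix.of fun i j => ∫ s, M s i j ∂μ) x) =
      ∫ s, inner ℂ y (Matrix.toEuclideanLin (M s) x) ∂μ := by
    simp only [inner_toEuclideanLin_eq_sum, Matrix.of_apply]
    rw [integral_finsetSum _ fun i _ => integrable_finsetSum _ fun j _ =>
      (hint i j).const_mul _]
    refine Finset.sum_congr rfl fun i _ => ?_
    rw [integral_finsetSum _ fun j _ => (hint i j).const_mul _]
    exact Finset.sum_congr rfl fun j _ => (integral_const_mul _ _).symm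
  rw [heq, ← integral_mul_const]
  refine norm_integral_le_of_norm_le (hg.mul_const _) ?_
  filter_upwards [h] with s hs using hs x y

/-- By the adjugate formula the entries are quotients of continuous functions of s, so no
invertibility is needed. -/
theorem measurable_inv_add_smul (A B : Matrix (Fin n) (Fin n) ℂ) (i j : Fin n) :
    Measurable fun s : ℝ => (A + (s : ℂ) • B)⁻¹ i j := by
  have hc : Continuous fun s : ℝ => A + (s : ℂ) • B := by fun_prop
  simp only [Matrix.inv_def, Matrix.smul_apply, Ring.inverse_eq_inv', smul_eq_mul]
  refine Measurable.mul hc.matrix_det.measurable.inv ?_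
  exact (hc.matrix_adjugate.matrix_elem i j).measurable

/-- Needed to integrate over t in the logarithmic mean; it follows from joint measurability of the
integrand in (t, s). -/
theorem stronglyMeasurable_geomMean (A B : Matrix (Fin n) (Fin n) ℂ) (i j : Fin n) :
    StronglyMeasurable fun t : ℝ => geomMean t A B i j := by
  simp only [geomMean, Matrix.of_apply]
  refine StronglyMeasurable.mul ?_ ?_
  · exact Measurable.stronglyMeasurable (by fun_prop)
  · have h : Measurable fun p : ℝ × ℝ =>
        ((p.2 ^ (p.1 - 1) : ℝ) : ℂ) * (A⁻¹ + (p.2 : ℂ) • B⁻¹)⁻¹ i j := by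
      refine Measurable.mul (by fun_prop) ?_
      exact (measurable_inv_add_smul A⁻¹ B⁻¹ i j).comp measurable_snd
    exact h.stronglyMeasurable.integral_prod_right'

variable {A B : Matrix (Fin n) (Fin n) ℂ} {α : ℝ}

theorem norm_inner_geomMean_le (hα0 : 0 ≤ α) (hα : α < Real.pi / 2)
    (hA : IsSectorial α A) (hB : IsSectorial α B) {a b : ℝ} (ha0 : 0 < a) (hb0 : 0 < b)
    (ha : ∀ x, (inner ℂ x (Matrix.toEuclideanLin A x)).re ≤ a * ‖x‖ ^ 2)
    (hb : ∀ x, (inner ℂ x (Matrix.toEuclideanLin B x)).re ≤ b * ‖x‖ ^ 2)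
    {t : ℝ} (ht0 : 0 < t) (ht1 : t < 1) (x y : EuclideanSpace ℂ (Fin n)) :
    ‖inner ℂ y (Matrix.toEuclideanLin (geomMean t A B) x)‖ ≤
      (1 / Real.cos α) ^ 2 * scalarGeomMean t a b * (‖x‖ * ‖y‖) := by
  obtain ⟨hint, hval⟩ := integrableOn_and_integral_rpow_mul_inv ht0 ht1 (inv_pos.2 ha0)
    (inv_pos.2 hb0)
  have hsin : 0 < Real.sin (Real.pi * t) :=
    Real.sin_pos_of_pos_of_lt_pi (by positivity) (by nlinarith [Real.pi_pos])
  have key := norm_inner_integral_le (μ := volume.restrict (Ioi (0 : ℝ)))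
    (M := fun s => ((s ^ (t - 1) : ℝ) : ℂ) • (A⁻¹ + (s : ℂ) • B⁻¹)⁻¹)
    (g := fun s => (1 / Real.cos α) ^ 2 * (s ^ (t - 1) * (a⁻¹ + s * b⁻¹)⁻¹))
    (fun i j => (Measurable.mul (by fun_prop)
      (measurable_inv_add_smul A⁻¹ B⁻¹ i j)).aestronglyMeasurable)
    (hint.const_mul _) (by
      filter_upwards [ae_restrict_mem measurableSet_Ioi] with s hs x y
      have hs' : 0 < s := hs
      rw [map_smul, LinearMap.smul_apply, inner_smul_right, norm_mul, Complex.norm_real,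
        Real.norm_of_nonneg (by positivity)]
      calc _ ≤ s ^ (t - 1) * _ := mul_le_mul_of_nonneg_left
            (norm_inner_resolvent_le hα0 hα hA hB ha0 hb0 ha hb hs x y) (by positivity)
        _ = _ := by ring) x y
  rw [integral_const_mul, hval, inv_inv, inv_inv] at key
  have hG : geomMean t A B = ((Real.sin (Real.pi * t) / Real.pi : ℝ) : ℂ) •
      Matrix.of fun i j => ∫ s in Ioi (0 : ℝ),
        (((s ^ (t - 1) : ℝ) : ℂ) • (A⁻¹ + (s : ℂ) • B⁻¹)⁻¹) i j := rfl
  rw [hG, map_smul, LinearMap.smul_apply, inner_smul_right, norm_mul, Complex.norm_real,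
    Real.norm_of_nonneg (by positivity)]
  refine (mul_le_mul_of_nonneg_left key (by positivity)).trans_eq ?_
  rw [scalarGeomMean]
  have := Real.pi_pos
  field_simp

theorem integrableOn_scalarGeomMean {a b : ℝ} (ha : 0 < a) (hb : 0 < b) :
    IntegrableOn (fun t => scalarGeomMean t a b) (Ioo 0 1) := by
  have hc : Continuous fun t => scalarGeomMean t a b := by
    unfold scalarGeomMean
    exact ((Real.continuous_const_rpow ha.ne').comp (by fun_prop)).mul
      (Real.continuous_const_rpow hb.ne')
  exact (hc.integrableOn_Icc (a := 0) (b := 1)).mono_set Ioo_subset_Icc_self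

theorem norm_inner_logMean_le (hα0 : 0 ≤ α) (hα : α < Real.pi / 2)
    (hA : IsSectorial α A) (hB : IsSectorial α B) {a b : ℝ} (ha0 : 0 < a) (hb0 : 0 < b)
    (ha : ∀ x, (inner ℂ x (Matrix.toEuclideanLin A x)).re ≤ a * ‖x‖ ^ 2)
    (hb : ∀ x, (inner ℂ x (Matrix.toEuclideanLin B x)).re ≤ b * ‖x‖ ^ 2)
    (x y : EuclideanSpace ℂ (Fin n)) :
    ‖inner ℂ y (Matrix.toEuclideanLin (logMean A B) x)‖ ≤
      (1 / Real.cos α) ^ 2 * scalarLogMean a b * (‖x‖ * ‖y‖) := by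
  have key := norm_inner_integral_le (μ := volume.restrict (Ioo (0 : ℝ) 1))
    (M := fun t => geomMean t A B) (g := fun t => (1 / Real.cos α) ^ 2 * scalarGeomMean t a b)
    (fun i j => (stronglyMeasurable_geomMean A B i j).aestronglyMeasurable)
    ((integrableOn_scalarGeomMean ha0 hb0).const_mul _) (by
      filter_upwards [ae_restrict_mem measurableSet_Ioo] with t ht x y
      exact norm_inner_geomMean_le hα0 hα hA hB ha0 hb0 ha hb ht.1 ht.2 x y) x y
  rwa [integral_const_mul] at key

theorem norm_inner_heinzMean_le (hα0 : 0 ≤ α) (hα : α < Real.pi / 2)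
    (hA : IsSectorial α A) (hB : IsSectorial α B) {a b : ℝ} (ha0 : 0 < a) (hb0 : 0 < b)
    (ha : ∀ x, (inner ℂ x (Matrix.toEuclideanLin A x)).re ≤ a * ‖x‖ ^ 2)
    (hb : ∀ x, (inner ℂ x (Matrix.toEuclideanLin B x)).re ≤ b * ‖x‖ ^ 2)
    {t : ℝ} (ht0 : 0 < t) (ht1 : t < 1) (x y : EuclideanSpace ℂ (Fin n)) :
    ‖inner ℂ y (Matrix.toEuclideanLin (heinzMean t A B) x)‖ ≤
      (1 / Real.cos α) ^ 2 * scalarHeinzMean t a b * (‖x‖ * ‖y‖) := by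
  have h1 := norm_inner_geomMean_le hα0 hα hA hB ha0 hb0 ha hb ht0 ht1 x y
  have h2 := norm_inner_geomMean_le hα0 hα hA hB ha0 hb0 ha hb (t := 1 - t)
    (by linarith) (by linarith) x y
  rw [heinzMean, map_smul, map_add, LinearMap.smul_apply, LinearMap.add_apply, inner_smul_right,
    inner_add_right, norm_mul, scalarHeinzMean]
  have h3 := norm_add_le (inner ℂ y (Matrix.toEuclideanLin (geomMean t A B) x))
    (inner ℂ y (Matrix.toEuclideanLin (geomMean (1 - t) A B) x))
  have h4 : ‖(1 / 2 : ℂ)‖ = 1 / 2 := by norm_num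
  rw [h4]
  linarith

end Integral

/-! ### The q-numerical radius and its control of the numerical range. -/

section Radius

variable {n : ℕ} {q : ℂ}

theorem bddAbove_norm_qNumericalRange (q : ℂ) (A : Matrix (Fin n) (Fin n) ℂ) :
    BddAbove ((fun z : ℂ => ‖z‖) '' qNumericalRange q A) := by
  refine ⟨‖(Matrix.toEuclideanLin A).toContinuousLinearMap‖, ?_⟩
  rintro _ ⟨_, ⟨x, y, hx, hy, -, rfl⟩, rfl⟩
  refine (norm_inner_le_norm _ _).trans ?_
  rw [hy, one_mul]
  simpa [hx] using! (Matrix.toEuclideanLin A).toContinuousLinearMap.le_opNorm x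

theorem norm_inner_le_qNumericalRadius (A : Matrix (Fin n) (Fin n) ℂ)
    {x y : EuclideanSpace ℂ (Fin n)} (hx : ‖x‖ = 1) (hy : ‖y‖ = 1) (hxy : inner ℂ y x = q) :
    ‖inner ℂ y (Matrix.toEuclideanLin A x)‖ ≤ qNumericalRadius q A :=
  le_csSup (bddAbove_norm_qNumericalRange q A) ⟨_, ⟨x, y, hx, hy, hxy, rfl⟩, rfl⟩

/-- If some vector is not a multiple of x, its component orthogonal to x can be rescaled. Otherwise
x₀ and y₀ are both unimodular multiples of x, which forces ‖q‖ = 1, and z = 0 works. -/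
theorem exists_orthogonal_norm_eq {F : Type*} [NormedAddCommGroup F] [InnerProductSpace ℂ F]
    (hq1 : ‖q‖ ≤ 1) {x₀ y₀ : F} (hx₀ : ‖x₀‖ = 1) (hy₀ : ‖y₀‖ = 1) (hq : inner ℂ y₀ x₀ = q)
    {x : F} (hx : ‖x‖ = 1) : ∃ z : F, inner ℂ z x = 0 ∧ ‖z‖ ^ 2 = 1 - ‖q‖ ^ 2 := by
  have horth : ∀ u : F, inner ℂ (u - inner ℂ x u • x) x = 0 := fun u => by
    rw [inner_sub_left, inner_smul_left, inner_conj_symm, inner_self_eq_norm_sq_to_K, hx]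
    simp
  by_cases h : ∃ u : F, u - inner ℂ x u • x ≠ 0
  · obtain ⟨u, hu⟩ := h
    set z := u - inner ℂ x u • x
    refine ⟨((√(1 - ‖q‖ ^ 2) / ‖z‖ : ℝ) : ℂ) • z, ?_, ?_⟩
    · rw [inner_smul_left, horth u, mul_zero]
    · have h0 : 0 ≤ 1 - ‖q‖ ^ 2 := by nlinarith [norm_nonneg q]
      have hz : ‖z‖ ≠ 0 := norm_ne_zero_iff.2 hu
      rw [norm_smul, Complex.norm_real, Real.norm_of_nonneg (by positivity), div_mul_cancel₀ _ hz,
        Real.sq_sqrt h0]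
  · push Not at h
    have hx' := sub_eq_zero.1 (h x₀)
    have hy' := sub_eq_zero.1 (h y₀)
    have h1 : ‖inner ℂ x x₀‖ = 1 := by
      have := congrArg norm hx'
      rwa [hx₀, norm_smul, hx, mul_one, eq_comm] at this
    have h2 : ‖inner ℂ x y₀‖ = 1 := by
      have := congrArg norm hy'
      rwa [hy₀, norm_smul, hx, mul_one, eq_comm] at this
    have h3 : ‖q‖ = 1 := by
      rw [← hq, hy', inner_smul_left, norm_mul, Complex.norm_conj, h1, h2, mul_one]
    exact ⟨0, by simp, by simp [h3]⟩

/-- Both y = conj q • x + z and y = conj q • x - z, with z orthogonal to x, are admissible partners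
of x; averaging the two values cancels the z-term. -/
theorem norm_mul_norm_inner_self_le (A : Matrix (Fin n) (Fin n) ℂ) (hq1 : ‖q‖ ≤ 1)
    {x₀ y₀ : EuclideanSpace ℂ (Fin n)} (hx₀ : ‖x₀‖ = 1) (hy₀ : ‖y₀‖ = 1)
    (hq : inner ℂ y₀ x₀ = q) {x : EuclideanSpace ℂ (Fin n)} (hx : ‖x‖ = 1) :
    ‖q‖ * ‖inner ℂ x (Matrix.toEuclideanLin A x)‖ ≤ qNumericalRadius q A := by
  obtain ⟨z, hz, hzn⟩ := exists_orthogonal_norm_eq hq1 hx₀ hy₀ hq hx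
  have hbound : ∀ w : EuclideanSpace ℂ (Fin n), inner ℂ w x = 0 → ‖w‖ ^ 2 = 1 - ‖q‖ ^ 2 →
      ‖q * inner ℂ x (Matrix.toEuclideanLin A x) + inner ℂ w (Matrix.toEuclideanLin A x)‖ ≤
        qNumericalRadius q A := by
    intro w hw hwn
    have hy : ‖conj q • x + w‖ = 1 := by
      have h0 : inner ℂ (conj q • x) w = 0 := by
        rw [inner_smul_left, ← inner_conj_symm, hw, map_zero, mul_zero]
      have h1 := norm_add_sq_eq_norm_sq_add_norm_sq_of_inner_eq_zero _ _ h0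
      rw [norm_smul, Complex.norm_conj, hx, mul_one, ← sq, ← sq, ← sq, hwn] at h1
      have h2 : ‖conj q • x + w‖ ^ 2 = 1 := by linarith
      exact (pow_eq_one_iff_of_nonneg (norm_nonneg _) two_ne_zero).1 h2
    have hyx : inner ℂ (conj q • x + w) x = q := by
      rw [inner_add_left, inner_smul_left, hw, inner_self_eq_norm_sq_to_K, hx]
      simp
    have h3 := norm_inner_le_qNumericalRadius A hx hy hyx
    rwa [inner_add_left, inner_smul_left, Complex.conj_conj] at h3
  have h1 := hbound z hz hzn
  have h2 := hbound (-z) (by simp [hz]) (by simpa using hzn)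
  rw [inner_neg_left, ← sub_eq_add_neg] at h2
  have h3 := norm_add_le
    (q * inner ℂ x (Matrix.toEuclideanLin A x) + inner ℂ z (Matrix.toEuclideanLin A x))
    (q * inner ℂ x (Matrix.toEuclideanLin A x) - inner ℂ z (Matrix.toEuclideanLin A x))
  rw [add_add_sub_cancel, ← two_mul, norm_mul, norm_mul, Complex.norm_ofNat] at h3
  linarith

variable {A : Matrix (Fin n) (Fin n) ℂ} {α : ℝ}

theorem IsSectorial.qNumericalRadius_pos (hA : IsSectorial α A) (hq0 : q ≠ 0) (hq1 : ‖q‖ ≤ 1)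
    {x₀ y₀ : EuclideanSpace ℂ (Fin n)} (hx₀ : ‖x₀‖ = 1) (hy₀ : ‖y₀‖ = 1)
    (hq : inner ℂ y₀ x₀ = q) : 0 < qNumericalRadius q A := by
  refine lt_of_lt_of_le ?_ (norm_mul_norm_inner_self_le A hq1 hx₀ hy₀ hq hx₀)
  have h1 := hA.re_inner_pos (x := x₀) (by rintro rfl; simp at hx₀)
  exact mul_pos (norm_pos_iff.2 hq0) (h1.trans_le (Complex.re_le_norm _))

theorem re_inner_le_qNumericalRadius_div (A : Matrix (Fin n) (Fin n) ℂ) (hq0 : q ≠ 0)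
    (hq1 : ‖q‖ ≤ 1) {x₀ y₀ : EuclideanSpace ℂ (Fin n)} (hx₀ : ‖x₀‖ = 1) (hy₀ : ‖y₀‖ = 1)
    (hq : inner ℂ y₀ x₀ = q) (x : EuclideanSpace ℂ (Fin n)) :
    (inner ℂ x (Matrix.toEuclideanLin A x)).re ≤ qNumericalRadius q A / ‖q‖ * ‖x‖ ^ 2 := by
  rcases eq_or_ne x 0 with rfl | hx
  · simp
  · obtain ⟨u, hu, h⟩ := inner_toEuclideanLin_self_eq A hx
    have h1 := norm_mul_norm_inner_self_le A hq1 hx₀ hy₀ hq hu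
    have h2 : ‖inner ℂ u (Matrix.toEuclideanLin A u)‖ ≤ qNumericalRadius q A / ‖q‖ := by
      rw [le_div_iff₀ (norm_pos_iff.2 hq0)]
      linarith
    rw [h, Complex.re_ofReal_mul, mul_comm]
    exact mul_le_mul_of_nonneg_right ((Complex.re_le_norm _).trans h2) (by positivity)

theorem scalarGeomMean_nonneg {t a b : ℝ} (ha : 0 ≤ a) (hb : 0 ≤ b) :
    0 ≤ scalarGeomMean t a b := by
  unfold scalarGeomMean
  positivity

theorem scalarLogMean_nonneg {a b : ℝ} (ha : 0 ≤ a) (hb : 0 ≤ b) : 0 ≤ scalarLogMean a b :=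
  integral_nonneg fun _ => scalarGeomMean_nonneg ha hb

theorem scalarHeinzMean_nonneg {t a b : ℝ} (ha : 0 ≤ a) (hb : 0 ≤ b) :
    0 ≤ scalarHeinzMean t a b := by
  unfold scalarHeinzMean
  linarith [scalarGeomMean_nonneg (t := t) ha hb, scalarGeomMean_nonneg (t := 1 - t) ha hb]

theorem scalarGeomMean_div {t a b c : ℝ} (ha : 0 ≤ a) (hb : 0 ≤ b) (hc : 0 < c) :
    scalarGeomMean t (a / c) (b / c) = scalarGeomMean t a b / c := by
  have h : c ^ (1 - t) * c ^ t = c := by rw [← Real.rpow_add hc]; simp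
  rw [scalarGeomMean, scalarGeomMean, Real.div_rpow ha hc.le, Real.div_rpow hb hc.le,
    div_mul_div_comm, h]

theorem scalarLogMean_div {a b c : ℝ} (ha : 0 ≤ a) (hb : 0 ≤ b) (hc : 0 < c) :
    scalarLogMean (a / c) (b / c) = scalarLogMean a b / c := by
  simp only [scalarLogMean, scalarGeomMean_div ha hb hc, integral_div]

theorem scalarHeinzMean_div {t a b c : ℝ} (ha : 0 ≤ a) (hb : 0 ≤ b) (hc : 0 < c) :
    scalarHeinzMean t (a / c) (b / c) = scalarHeinzMean t a b / c := by
  simp only [scalarHeinzMean, scalarGeomMean_div ha hb hc]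
  ring

theorem qNumericalRadius_nonneg (q : ℂ) (A : Matrix (Fin n) (Fin n) ℂ) :
    0 ≤ qNumericalRadius q A := by
  refine Real.sSup_nonneg ?_
  rintro _ ⟨z, -, rfl⟩
  exact norm_nonneg z

theorem sq_mul_qNumericalRadius_le (hα0 : 0 ≤ α) (hα : α < Real.pi / 2) (hq0 : q ≠ 0)
    (hq1 : ‖q‖ ≤ 1) (M : Matrix (Fin n) (Fin n) ℂ) {m : ℝ} (hm : 0 ≤ m)
    (h : ∀ x y : EuclideanSpace ℂ (Fin n), ‖x‖ = 1 → ‖y‖ = 1 → inner ℂ y x = q →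
      ‖inner ℂ y (Matrix.toEuclideanLin M x)‖ ≤ (1 / Real.cos α) ^ 2 * (m / ‖q‖)) :
    ‖q‖ ^ 2 * qNumericalRadius q M ≤ (1 / Real.cos α) ^ 3 * m := by
  have hc : 0 < Real.cos α := Real.cos_pos_of_mem_Ioo ⟨by linarith [Real.pi_pos], hα⟩
  have hsec : 1 ≤ 1 / Real.cos α := (one_le_div hc).2 (Real.cos_le_one α)
  have hq : 0 < ‖q‖ := norm_pos_iff.2 hq0
  have hw : qNumericalRadius q M ≤ (1 / Real.cos α) ^ 2 * (m / ‖q‖) := by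
    -- Nonnegativity of the bound covers an empty q-numerical range, where the supremum is 0.
    refine Real.sSup_le ?_ (by positivity)
    rintro _ ⟨_, ⟨x, y, hx, hy, hxy, rfl⟩, rfl⟩
    exact h x y hx hy hxy
  calc ‖q‖ ^ 2 * qNumericalRadius q M ≤ ‖q‖ ^ 2 * ((1 / Real.cos α) ^ 2 * (m / ‖q‖)) := by gcongr
    _ = ‖q‖ * ((1 / Real.cos α) ^ 2 * m) := by field_simp
    -- One factor ‖q‖ ≤ 1 and one factor sec α ≥ 1 are given away here.
    _ ≤ 1 * ((1 / Real.cos α) ^ 3 * m) := by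
      gcongr
      · norm_num
    _ = _ := one_mul _

end Radius

end SectorialMeans

open SectorialMeans in
theorem mainTheorem8 (n : ℕ) (α : ℝ) (hα0 : 0 ≤ α) (hα : α < Real.pi / 2)
    (A B : Matrix (Fin n) (Fin n) ℂ)
    (hA : SectorialMeans.IsSectorial α A) (hB : SectorialMeans.IsSectorial α B)
    (q : ℂ) (hq0 : q ≠ 0) (hq1 : ‖q‖ ≤ 1) :
    ‖q‖ ^ 2 * SectorialMeans.qNumericalRadius q (SectorialMeans.logMean A B) ≤
        (1 / Real.cos α) ^ 3 *
          SectorialMeans.scalarLogMean (SectorialMeans.qNumericalRadius q A)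
            (SectorialMeans.qNumericalRadius q B) ∧
    ∀ t : ℝ, 0 < t → t < 1 →
      ‖q‖ ^ 2 * SectorialMeans.qNumericalRadius q (SectorialMeans.heinzMean t A B) ≤
        (1 / Real.cos α) ^ 3 *
          SectorialMeans.scalarHeinzMean t (SectorialMeans.qNumericalRadius q A)
            (SectorialMeans.qNumericalRadius q B) := by
  have hq : 0 < ‖q‖ := norm_pos_iff.2 hq0
  have hwA := qNumericalRadius_nonneg q A
  have hwB := qNumericalRadius_nonneg q B
  refine ⟨sq_mul_qNumericalRadius_le hα0 hα hq0 hq1 _ (scalarLogMean_nonneg hwA hwB) ?_,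
    fun t ht0 ht1 =>
      sq_mul_qNumericalRadius_le hα0 hα hq0 hq1 _ (scalarHeinzMean_nonneg hwA hwB) ?_⟩
  all_goals
    -- The pair (x, y) at which the form is estimated also witnesses that the q-numerical range is
    -- nonempty, so both radii are positive and can serve as a and b after division by ‖q‖.
    intro x y hx hy hxy
    have hA0 := div_pos (hA.qNumericalRadius_pos hq0 hq1 hx hy hxy) hq
    have hB0 := div_pos (hB.qNumericalRadius_pos hq0 hq1 hx hy hxy) hq
    have hA1 := re_inner_le_qNumericalRadius_div A hq0 hq1 hx hy hxy
    have hB1 := re_inner_le_qNumericalRadius_div B hq0 hq1 hx hy hxy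
  · simpa [hx, hy, scalarLogMean_div hwA hwB hq] using
      norm_inner_logMean_le hα0 hα hA hB hA0 hB0 hA1 hB1 x y
  · simpa [hx, hy, scalarHeinzMean_div hwA hwB hq] using
      norm_inner_heinzMean_le hα0 hα hA hB hA0 hB0 hA1 hB1 ht0 ht1 x y
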